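/- Let $n\ge 1$ be an integer and let $HC(n)$ be the honeycomb network formed by a central hexagon and the $n-1$ rings of hexagons around it. In each hexagon of $HC(n)$ draw the hexagram (six-pointed star) whose tips are the midpoints of the six sides, place vertices at all tips and at all crossings of the hexagrams (a tip on a side common to two hexagons is a single vertex), and delete the honeycomb; the result, the dominating oxide network, consists of six triangles per hexagon. Its vertices are called oxide vertices. In each of these triangles, with corners $a,b,c$, insert three new vertices, one for each of the pairs $\{a,b\},\{b,c\},\{c,a\}$, join each new vertex to the two corners of its pair, and join the three new vertices with one another (so that each triangle becomes a planar octahedron). The resulting graph is the dominating planar octahedron network $DPOH(n)$. For a finite simple graph $G$ let $\deg(u)$ be the degree of $u$, let $S_u=\sum_{v\in N_G(u)}\deg(v)$, and put $$ABC(G)=\sum_{uv\in E(G)}\sqrt{\frac{\deg(u)+\deg(v)-2}{\deg(u)\deg(v)}},\qquad GA(G)=\sum_{uv\in E(G)}\frac{2\sqrt{\deg(u)\deg(v)}}{\deg(u)+\deg(v)},$$ $$ABC_4(G)=\sum_{uv\in E(G)}\sqrt{\frac{S_u+S_v-2}{S_uS_v}},\qquad GA_5(G)=\sum_{uv\in E(G)}\frac{2\sqrt{S_uS_v}}{S_u+S_v}.$$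 **Theorem.** Let $G\cong DPOH(n)$. Then, for $n\ge1$, $$ABC(G)=\tfrac18\Big(72\sqrt5\,(1-3n+3n^2)+6\sqrt{14}\,(5-13n+9n^2)+12\sqrt6\,(1-5n+9n^2)\Big),$$ $$GA(G)=12(3+2\sqrt2)(1-3n+3n^2),$$ and, for $n\ge3$, $$\begin{aligned}ABC_4(G)=\tfrac1{440}\Big(&66\sqrt{78}+5280(n-1)+120\sqrt{330}(n-1)+24\sqrt{2255}(n-1)+24\sqrt{3410}(n-1)\\&+264\sqrt{29}\,n+88\sqrt{930}\,n+528\sqrt{35}(2n-1)+132\sqrt{38}(2n-1)\\&+330\sqrt{46}(2-5n+3n^2)+55\sqrt{94}(10-19n+9n^2)+220\sqrt{35}(8-17n+9n^2)\Big),\end{aligned}$$ $$\begin{aligned}GA_5(G)=\;&96+\tfrac{96}{23}\sqrt{33}(n-1)+\tfrac32\sqrt{55}(n-1)+\tfrac{96}{17}\sqrt{66}(n-1)+\tfrac87\sqrt{110}(n-1)\\&-192n+8\sqrt2\,n+6\sqrt{15}\,n+108n^2+\tfrac{48}{11}\sqrt{30}(2n-1)+8\sqrt2(8-17n+9n^2).\end{aligned}$$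 -/

import Mathlib

/-! ### Degree based indices of a finite simple graph -/

namespace SimpleGraph

variable {V : Type*} (G : SimpleGraph V) [Fintype V] [DecidableEq V] [DecidableRel G.Adj]

/-- The sum `∑_{uv ∈ E(G)} f(u, v)` of a symmetric function over the (unordered) edges. -/
def edgeSum (f : V → V → ℝ) (hf : ∀ u v, f u v = f v u) : ℝ :=
  ∑ e ∈ G.edgeFinset, Sym2.lift ⟨f, hf⟩ e

/-- `S_u`, the sum of the degrees of the neighbours of `u`. -/
def neighborDegreeSum (u : V) : ℕ := ∑ v ∈ G.neighborFinset u, G.degree v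

/-- The atom-bond connectivity index, `∑_{uv} √((d_u + d_v - 2) / (d_u d_v))`. -/
noncomputable def ABC : ℝ :=
  G.edgeSum
    (fun u v => √(((G.degree u : ℝ) + G.degree v - 2) / ((G.degree u : ℝ) * G.degree v)))
    (fun u v => by
      rw [add_comm (G.degree u : ℝ), mul_comm (G.degree u : ℝ)])

/-- The geometric-arithmetic index, `∑_{uv} 2√(d_u d_v) / (d_u + d_v)`. -/
noncomputable def GA : ℝ :=
  G.edgeSum
    (fun u v => 2 * √((G.degree u : ℝ) * G.degree v) / ((G.degree u : ℝ) + G.degree v))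
    (fun u v => by
      rw [add_comm (G.degree u : ℝ), mul_comm (G.degree u : ℝ)])

/-- The fourth atom-bond connectivity index, `∑_{uv} √((S_u + S_v - 2) / (S_u S_v))`. -/
noncomputable def ABC4 : ℝ :=
  G.edgeSum
    (fun u v => √(((G.neighborDegreeSum u : ℝ) + G.neighborDegreeSum v - 2) /
      ((G.neighborDegreeSum u : ℝ) * G.neighborDegreeSum v)))
    (fun u v => by
      rw [add_comm (G.neighborDegreeSum u : ℝ), mul_comm (G.neighborDegreeSum u : ℝ)])

/-- The fifth geometric-arithmetic index, `∑_{uv} 2√(S_u S_v) / (S_u + S_v)`. -/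
noncomputable def GA5 : ℝ :=
  G.edgeSum
    (fun u v => 2 * √((G.neighborDegreeSum u : ℝ) * G.neighborDegreeSum v) /
      ((G.neighborDegreeSum u : ℝ) + G.neighborDegreeSum v))
    (fun u v => by
      rw [add_comm (G.neighborDegreeSum u : ℝ), mul_comm (G.neighborDegreeSum u : ℝ)])

end SimpleGraph

/-! ### The dominating planar octahedron network

Points of the plane are written in the basis of two lattice vectors of equal length that enclose
an angle of 60 degrees. The honeycomb network `HC(n)` is a central hexagon with `n - 1` rings of
hexagons around it; the hexagon with index `c` is centred at the point `6 c`, so that the midpoints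
of its six sides are the points `6 c + 3 d` with `d` one of the six unit vectors.

The dominating oxide network arises from `HC(n)` by drawing in each hexagon the hexagram
whose tips are the six midpoints of the sides, putting vertices at the tips and at the crossings,
and deleting the honeycomb. It consists of six triangles per hexagon, one at each tip. The
dominating silicate network has in addition a silicon vertex in each of these triangles, joined to
its three corners, the oxide vertices; a triangle with its silicon vertex is a silicate cell.
The drawing algorithm of planar octahedron networks, applied to this silicate network, puts a new
vertex in each triangular face `silicon, oxide, oxide`, joins it to the two oxide vertices of the
face, joins the three new vertices of each cell with one another, and removes silicon. -/

namespace DPOH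

/-- The six unit vectors of the triangular lattice, in cyclic order. -/
def dir : Fin 6 → ℤ × ℤ := ![(1, 0), (0, 1), (-1, 1), (-1, 0), (0, -1), (1, -1)]

/-- The indices of the hexagons of `HC(n)`: those at lattice distance less than `n` from `0`. -/
noncomputable def hexagons (n : ℕ) : Finset (ℤ × ℤ) :=
  {c ∈ Finset.Ioo (-(n : ℤ)) n ×ˢ Finset.Ioo (-(n : ℤ)) n |
    -(n : ℤ) < c.1 + c.2 ∧ c.1 + c.2 < (n : ℤ)}

/-- The silicate cells: six for each hexagon, one at the midpoint of each of its sides. -/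
abbrev Cell (n : ℕ) : Type := {c : ℤ × ℤ // c ∈ hexagons n} × Fin 6

/-- The three oxide vertices of a silicate cell, as points of the plane: a tip of the hexagram
(the midpoint of a side of the hexagon) and the two neighbouring crossings. -/
def corner {n : ℕ} (t : Cell n) : Fin 3 → ℤ × ℤ :=
  ![6 • t.1.1 + 3 • dir t.2,
    6 • t.1.1 + dir t.2 + dir (t.2 + 1),
    6 • t.1.1 + dir t.2 + dir (t.2 - 1)]

/-- The oxide vertices: all points that are a corner of some cell. Hexagons with a common side share
the tip at its midpoint, and adjacent triangles of a hexagram share a crossing. -/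
abbrev Oxide (n : ℕ) : Type :=
  {p : ℤ × ℤ // p ∈ Finset.univ.image fun q : Cell n × Fin 3 => corner q.1 q.2}

/-- The dominating oxide network: two oxide vertices are adjacent when they are distinct corners of
one triangle. -/
def oxideNetwork (n : ℕ) : SimpleGraph (Oxide n) where
  Adj p q := p ≠ q ∧ ∃ t : Cell n, (∃ j, corner t j = p.1) ∧ ∃ k, corner t k = q.1
  symm := ⟨fun _ _ h => ⟨h.1.symm, h.2.imp fun _ ht => ⟨ht.2, ht.1⟩⟩⟩
  loopless := ⟨fun _ h => h.1 rfl⟩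

/-- The vertices of `DPOH(n)`: the oxide vertices, and one new vertex `(t, j)` for each face of each
cell `t`, namely the face spanned by silicon and the two corners of `t` other than corner `j`. -/
abbrev Vertex (n : ℕ) : Type := Oxide n ⊕ (Cell n × Fin 3)

/-- Adjacency in `DPOH(n)`. -/
def Adj (n : ℕ) : Vertex n → Vertex n → Prop
  | .inl p, .inl q => (oxideNetwork n).Adj p q
  | .inl p, .inr f => ∃ k, k ≠ f.2 ∧ corner f.1 k = p.1
  | .inr f, .inl p => ∃ k, k ≠ f.2 ∧ corner f.1 k = p.1
  | .inr f, .inr g => f.1 = g.1 ∧ f.2 ≠ g.2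

/-- The dominating planar octahedron network `DPOH(n)`. -/
def network (n : ℕ) : SimpleGraph (Vertex n) where
  Adj := Adj n
  symm := ⟨by
    rintro (p | f) (q | g) h
    · exact SimpleGraph.Adj.symm (G := oxideNetwork n) h
    · exact h
    · exact h
    · exact ⟨h.1.symm, h.2.symm⟩⟩
  loopless := ⟨by
    rintro (p | f) h
    · exact h.1 rfl
    · exact h.2 rfl⟩

end DPOH

/-
The network is an edge-disjoint union of octahedra, one for each cell. The octahedron is 4-regular,
so the degree of a vertex is four times the number of cells through it: a new vertex lies in one
cell, a crossing in two, and a tip in one or two according as the side it halves is a side of one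
or of two hexagons. The labels of the six vertices of a cell, both degrees and neighbour degree
sums, therefore depend only on the side of its tip and the two adjacent sides of the same hexagon.
Rotation by 60 degrees reduces the six cells of a hexagon to one, and each of the possible
patterns of three consecutive sides is realised by a number of hexagons that can be counted: one
corner, four segments of `n - 1` hexagons, and the remaining hexagons, all of whose three sides
are shared.
-/

open Finset

section EdgeDecomposition

variable {ι V W : Type*} {G : SimpleGraph V} {H : SimpleGraph W}

/-- A decomposition of `G` into copies of `H`: every edge of `G` is the image of exactly one edge
of `H` under exactly one of the homomorphisms `φ i`. Edges are given by ordered pairs of adjacent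
vertices, and different copies may share vertices. -/
structure IsEdgeDecomposition (φ : ι → H →g G) : Prop where
  exists_of_adj : ∀ {u v}, G.Adj u v → ∃ i x y, H.Adj x y ∧ φ i x = u ∧ φ i y = v
  eq_of_adj : ∀ {i₁ i₂ x₁ x₂ y₁ y₂}, H.Adj x₁ y₁ → H.Adj x₂ y₂ → φ i₁ x₁ = φ i₂ x₂ →
    φ i₁ y₁ = φ i₂ y₂ → i₁ = i₂ ∧ x₁ = x₂ ∧ y₁ = y₂

/-- The incidences of a vertex `u` with a family of copies of `H`: the pairs of a copy and a
vertex of `H` that lies over `u` in this copy. -/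
def incidences [Fintype ι] [Fintype W] [DecidableEq V] (φ : ι → H →g G) (u : V) :
    Finset (ι × W) :=
  {q | φ q.1 q.2 = u}

theorem isEdgeDecomposition_iso (e : H ≃g G) :
    IsEdgeDecomposition fun _ : Unit => e.toHom where
  exists_of_adj {u v} h := ⟨(), e.symm u, e.symm v, e.symm.map_adj_iff.2 h, by simp, by simp⟩
  eq_of_adj _ _ hx hy := ⟨rfl, e.injective hx, e.injective hy⟩

namespace IsEdgeDecomposition

variable {φ : ι → H →g G} [Fintype ι] [Fintype W] [DecidableRel H.Adj]

theorem sum_neighborFinset [DecidableEq V] (hφ : IsEdgeDecomposition φ) {M : Type*}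
    [AddCommMonoid M] (u : V) [Fintype (G.neighborSet u)] (g : V → M) :
    ∑ v ∈ G.neighborFinset u, g v =
      ∑ q ∈ incidences φ u, ∑ y ∈ H.neighborFinset q.2, g (φ q.1 y) := by
  rw [sum_sigma']
  symm
  refine sum_bij (fun q _ => φ q.1.1 q.2) ?_ ?_ ?_ fun _ _ => rfl
  · rintro ⟨⟨i, x⟩, y⟩ hq
    simp only [mem_sigma, incidences, mem_filter_univ, SimpleGraph.mem_neighborFinset] at hq ⊢
    exact hq.1 ▸ (φ i).map_adj hq.2
  · rintro ⟨⟨i, x⟩, y⟩ hq ⟨⟨i', x'⟩, y'⟩ hq' hy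
    simp only [mem_sigma, incidences, mem_filter_univ, SimpleGraph.mem_neighborFinset] at hq hq'
    obtain ⟨rfl, rfl, rfl⟩ := hφ.eq_of_adj hq.2 hq'.2 (hq.1.trans hq'.1.symm) hy
    rfl
  · intro v hv
    obtain ⟨i, x, y, hxy, hx, hy⟩ := hφ.exists_of_adj ((G.mem_neighborFinset u v).1 hv)
    exact ⟨⟨(i, x), y⟩, by simp [incidences, hx, hxy], hy⟩

theorem degree_eq [DecidableEq V] (hφ : IsEdgeDecomposition φ) {d : ℕ}
    (hH : H.IsRegularOfDegree d) (u : V) [Fintype (G.neighborSet u)] :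
    G.degree u = #(incidences φ u) * d := by
  rw [← G.card_neighborFinset_eq_degree, card_eq_sum_ones, hφ.sum_neighborFinset]
  simp [hH.degree_eq]

theorem edgeSum_eq [Fintype V] [DecidableRel G.Adj] (hφ : IsEdgeDecomposition φ)
    (f : V → V → ℝ) (hf : ∀ u v, f u v = f v u) :
    G.edgeSum f hf =
      ∑ i, H.edgeSum (fun x y => f (φ i x) (φ i y)) fun _ _ => hf _ _ := by
  simp only [SimpleGraph.edgeSum]
  rw [← sum_product' univ H.edgeFinset fun i e =>
    Sym2.lift ⟨fun x y => f (φ i x) (φ i y), fun _ _ => hf _ _⟩ e]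
  symm
  refine sum_bij (fun q _ => q.2.map (φ q.1)) ?_ ?_ ?_ ?_
  · rintro ⟨i, ⟨x, y⟩⟩ hq
    simp only [mem_product, SimpleGraph.mem_edgeFinset] at hq ⊢
    exact (φ i).map_adj hq.2
  · rintro ⟨i, ⟨x, y⟩⟩ hq ⟨i', ⟨x', y'⟩⟩ hq' h
    simp only [mem_product, SimpleGraph.mem_edgeFinset] at hq hq'
    rcases Sym2.eq_iff.1 h with ⟨hx, hy⟩ | ⟨hx, hy⟩
    · obtain ⟨rfl, rfl, rfl⟩ := hφ.eq_of_adj hq.2 hq'.2 hx hy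
      rfl
    · obtain ⟨rfl, rfl, rfl⟩ := hφ.eq_of_adj hq.2 hq'.2.symm hx hy
      exact congrArg (Prod.mk i) Sym2.eq_swap
  · rintro ⟨u, v⟩ he
    obtain ⟨i, x, y, hxy, rfl, rfl⟩ := hφ.exists_of_adj (SimpleGraph.mem_edgeFinset.1 he)
    exact ⟨(i, s(x, y)), by simpa using hxy, rfl⟩
  · rintro ⟨i, ⟨x, y⟩⟩ -
    rfl

end IsEdgeDecomposition

section Iso

variable [Fintype V] [Fintype W] [DecidableRel G.Adj] [DecidableRel H.Adj]

theorem edgeSum_iso (e : G ≃g H) {f : V → V → ℝ} {f' : W → W → ℝ}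
    (hf : ∀ u v, f u v = f v u) (hf' : ∀ u v, f' u v = f' v u)
    (h : ∀ u v, f u v = f' (e u) (e v)) : G.edgeSum f hf = H.edgeSum f' hf' := by
  obtain rfl : f = fun u v => f' (e u) (e v) := funext₂ h
  simpa using ((isEdgeDecomposition_iso e).edgeSum_eq f' hf').symm

theorem neighborDegreeSum_iso (e : G ≃g H) (u : V) :
    H.neighborDegreeSum (e u) = G.neighborDegreeSum u :=
  .symm <| sum_equiv e.toEquiv (fun v => by simpa using e.map_adj_iff.symm) fun v _ =>
    (e.degree_eq v).symm

theorem ABC_iso (e : G ≃g H) : G.ABC = H.ABC :=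
  edgeSum_iso e _ _ fun u v => by simp only [e.degree_eq]

theorem GA_iso (e : G ≃g H) : G.GA = H.GA :=
  edgeSum_iso e _ _ fun u v => by simp only [e.degree_eq]

theorem ABC4_iso (e : G ≃g H) : G.ABC4 = H.ABC4 :=
  edgeSum_iso e _ _ fun u v => by simp only [neighborDegreeSum_iso]

theorem GA5_iso (e : G ≃g H) : G.GA5 = H.GA5 :=
  edgeSum_iso e _ _ fun u v => by simp only [neighborDegreeSum_iso]

end Iso

end EdgeDecomposition

namespace DPOH

variable {n : ℕ}

section Octahedron

/-- The axis through a vertex of the octahedron, whose antipodal pairs are `inl j`, `inr j`. -/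
def axis : Fin 3 ⊕ Fin 3 → Fin 3 := Sum.elim id id

/-- The graph of the octahedron: two vertices are adjacent unless they are equal or antipodal. In a
cell, `inl j` stands for corner `j` and `inr j` for the new vertex of the opposite face. -/
def octahedron : SimpleGraph (Fin 3 ⊕ Fin 3) := (⊤ : SimpleGraph (Fin 3)).comap axis

instance : DecidableRel octahedron.Adj := fun x y => inferInstanceAs (Decidable (axis x ≠ axis y))

theorem isRegularOfDegree_octahedron : octahedron.IsRegularOfDegree 4 := by
  intro x
  revert x
  decide

theorem sum_neighborFinset_octahedron {M : Type*} [AddCommMonoid M] (x : Fin 3 ⊕ Fin 3)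
    (g : Fin 3 ⊕ Fin 3 → M) :
    ∑ y ∈ octahedron.neighborFinset x, g y =
      ∑ j with j ≠ axis x, (g (.inl j) + g (.inr j)) := by
  simp only [SimpleGraph.neighborFinset_eq_filter, sum_filter, Fintype.sum_sum_type,
    ← sum_add_distrib]
  refine sum_congr rfl fun j _ => ?_
  have hinl : octahedron.Adj x (.inl j) ↔ j ≠ axis x := ne_comm
  have hinr : octahedron.Adj x (.inr j) ↔ j ≠ axis x := ne_comm
  simp only [hinl, hinr]
  split_ifs <;> simp

theorem edgeFinset_octahedron :
    octahedron.edgeFinset = univ.biUnion fun j : Fin 3 =>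
      {s(.inl j, .inl (j + 1)), s(.inl j, .inr (j + 1)), s(.inr j, .inl (j + 1)),
        s(.inr j, .inr (j + 1))} := by
  decide

theorem edgeSum_octahedron (f : Fin 3 ⊕ Fin 3 → Fin 3 ⊕ Fin 3 → ℝ) (hf : ∀ x y, f x y = f y x) :
    octahedron.edgeSum f hf =
      ∑ j : Fin 3, (f (.inl j) (.inl (j + 1)) + f (.inl j) (.inr (j + 1)) +
        f (.inr j) (.inl (j + 1)) + f (.inr j) (.inr (j + 1))) := by
  rw [SimpleGraph.edgeSum, edgeFinset_octahedron, sum_biUnion fun j _ k _ => by revert j k; decide]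
  refine sum_congr rfl fun j _ => ?_
  rw [sum_insert, sum_insert, sum_insert, sum_singleton]
  · simp only [Sym2.lift_mk, add_assoc]
  all_goals simp

end Octahedron

section Corners

/-- The position of a corner of a cell relative to the centre of its hexagon. -/
def offset (i : Fin 6) : Fin 3 → ℤ × ℤ :=
  ![3 • dir i, dir i + dir (i + 1), dir i + dir (i - 1)]

theorem corner_eq (t : Cell n) (j : Fin 3) : corner t j = 6 • t.1.1 + offset t.2 j := by
  fin_cases j <;> simp [corner, offset, add_assoc]

/-- The other cell at the tip of a cell, on the far side of the side of the hexagon. -/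
def opposite (t : Cell n) (h : t.1.1 + dir t.2 ∈ hexagons n) : Cell n :=
  (⟨t.1.1 + dir t.2, h⟩, t.2 + 3)

/-- The next cell of the same hexagon, in cyclic order. -/
def next (t : Cell n) : Cell n := (t.1, t.2 + 1)

/-- The previous cell of the same hexagon, in cyclic order. -/
def prev (t : Cell n) : Cell n := (t.1, t.2 - 1)

theorem offset_add_three_zero : ∀ i : Fin 6, offset (i + 3) 0 = offset i 0 - 6 • dir i := by
  decide

theorem offset_add_one_two : ∀ i : Fin 6, offset (i + 1) 2 = offset i 1 := by
  decide

theorem offset_sub_one_one : ∀ i : Fin 6, offset (i - 1) 1 = offset i 2 := by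
  decide

theorem cases_of_six_dvd_offset_sub : ∀ (i i' : Fin 6) (j j' : Fin 3),
    6 ∣ (offset i j - offset i' j').1 → 6 ∣ (offset i j - offset i' j').2 →
      (i' = i ∧ j' = j) ∨ (i' = i + 3 ∧ j = 0 ∧ j' = 0) ∨
      (i' = i + 1 ∧ j = 1 ∧ j' = 2) ∨ (i' = i - 1 ∧ j = 2 ∧ j' = 1) := by
  decide

-- Centres of hexagons are multiples of 6, so modulo 6 a corner is determined by its offset.
theorem corner_eq_corner_iff {t t' : Cell n} {j j' : Fin 3} :
    corner t j = corner t' j' ↔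
      (t' = t ∧ j' = j) ∨ (∃ h, t' = opposite t h ∧ j = 0 ∧ j' = 0) ∨
      (t' = next t ∧ j = 1 ∧ j' = 2) ∨ (t' = prev t ∧ j = 2 ∧ j' = 1) := by
  obtain ⟨⟨c, hc⟩, i⟩ := t
  obtain ⟨⟨c', hc'⟩, i'⟩ := t'
  simp only [corner_eq, opposite, next, prev, Prod.mk.injEq, Subtype.mk.injEq]
  constructor
  · intro h
    have hsub : offset i j - offset i' j' = 6 • (c' - c) := by
      rw [smul_sub, sub_eq_sub_iff_add_eq_add, add_comm, h, add_comm]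
    have hcancel (d : ℤ × ℤ) (hd : offset i j - offset i' j' = 6 • d) : c' = c + d :=
      eq_add_of_sub_eq' (smul_right_injective _ (by norm_num : (6 : ℕ) ≠ 0) (hsub.symm.trans hd))
    rcases cases_of_six_dvd_offset_sub i i' j j' (by simp [hsub]) (by simp [hsub]) with
      ⟨rfl, rfl⟩ | ⟨rfl, rfl, rfl⟩ | ⟨rfl, rfl, rfl⟩ | ⟨rfl, rfl, rfl⟩
    · simp [hcancel 0 (by simp)]
    · have hc : c' = c + dir i := hcancel _ (by simp [offset_add_three_zero])
      exact .inr (.inl ⟨hc ▸ hc', ⟨hc, rfl⟩, rfl, rfl⟩)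
    · simp [hcancel 0 (by simp [offset_add_one_two])]
    · simp [hcancel 0 (by simp [offset_sub_one_one])]
  · rintro (⟨⟨rfl, rfl⟩, rfl⟩ | ⟨-, ⟨rfl, rfl⟩, rfl, rfl⟩ | ⟨⟨rfl, rfl⟩, rfl, rfl⟩ |
      ⟨⟨rfl, rfl⟩, rfl, rfl⟩)
    · rfl
    · rw [offset_add_three_zero, smul_add]
      abel
    · rw [offset_add_one_two]
    · rw [offset_sub_one_one]

theorem opposite_ne_self (t : Cell n) (h : t.1.1 + dir t.2 ∈ hexagons n) : opposite t h ≠ t :=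
  fun e => by simpa [opposite] using congrArg Prod.snd e

theorem next_ne_self (t : Cell n) : next t ≠ t :=
  fun e => by simpa [next] using congrArg Prod.snd e

theorem prev_ne_self (t : Cell n) : prev t ≠ t :=
  fun e => by simpa [prev, sub_eq_add_neg] using congrArg Prod.snd e

theorem corner_injective (t : Cell n) : Function.Injective (corner t) := by
  intro j k h
  rcases corner_eq_corner_iff.1 h with ⟨-, h⟩ | ⟨h, e, -⟩ | ⟨e, -⟩ | ⟨e, -⟩
  · exact h.symm
  · exact absurd e.symm (opposite_ne_self t h)
  · exact absurd e.symm (next_ne_self t)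
  · exact absurd e.symm (prev_ne_self t)

theorem eq_of_two_common_corners {t t' : Cell n} {j k j' k' : Fin 3} (hjk : j ≠ k)
    (hj : corner t j = corner t' j') (hk : corner t k = corner t' k') : t = t' := by
  have hdir : ∀ i : Fin 6, i + 3 ≠ i + 1 ∧ i + 3 ≠ i - 1 ∧ i + 1 ≠ i - 1 := by decide
  have := hdir t.2
  have := corner_eq_corner_iff.1 hj
  have := corner_eq_corner_iff.1 hk
  grind [opposite, next, prev]

end Corners

section Cells

/-- The six vertices of the octahedron of a cell. -/
def octVertex (t : Cell n) : Fin 3 ⊕ Fin 3 → Vertex n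
  | .inl j => .inl ⟨corner t j, mem_image_of_mem _ (mem_univ (t, j))⟩
  | .inr j => .inr (t, j)

theorem octVertex_inl_eq_inl_iff {t t' : Cell n} {j j' : Fin 3} :
    octVertex t (.inl j) = octVertex t' (.inl j') ↔ corner t j = corner t' j' := by
  simp [octVertex]

theorem octVertex_inr_eq_iff {t t' : Cell n} {j : Fin 3} {x : Fin 3 ⊕ Fin 3} :
    octVertex t (.inr j) = octVertex t' x ↔ t' = t ∧ x = .inr j := by
  cases x <;> simp [octVertex, eq_comm]

theorem octVertex_injective (t : Cell n) : Function.Injective (octVertex t) := by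
  rintro (j | j) y h
  · rcases y with k | k
    · rw [corner_injective t (octVertex_inl_eq_inl_iff.1 h)]
    · simp [octVertex] at h
  · exact (octVertex_inr_eq_iff.1 h).2.symm

theorem adj_octVertex (t : Cell n) {x y : Fin 3 ⊕ Fin 3} (h : octahedron.Adj x y) :
    (network n).Adj (octVertex t x) (octVertex t y) := by
  rcases x with j | j <;> rcases y with k | k
  · exact ⟨fun e => h (corner_injective t (congrArg Subtype.val e)), t, ⟨j, rfl⟩, k, rfl⟩
  · exact ⟨j, h, rfl⟩
  · exact ⟨k, h.symm, rfl⟩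
  · exact ⟨rfl, h⟩

/-- The octahedron of a cell, as a copy of the octahedron graph in the network. -/
def octHom (t : Cell n) : octahedron →g network n := ⟨octVertex t, adj_octVertex t⟩

theorem exists_octVertex_of_adj {u v : Vertex n} (h : (network n).Adj u v) :
    ∃ t x y, octahedron.Adj x y ∧ octVertex t x = u ∧ octVertex t y = v := by
  rcases u with ⟨p, hp⟩ | ⟨t, j⟩ <;> rcases v with ⟨q, hq⟩ | ⟨t', k⟩
  · obtain ⟨hne, t, ⟨j, rfl⟩, k, rfl⟩ := h
    exact ⟨t, .inl j, .inl k, fun e : j = k => hne (by simp [e]), rfl, rfl⟩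
  · obtain ⟨j, hj, rfl⟩ := h
    exact ⟨t', .inl j, .inr k, hj, rfl, rfl⟩
  · obtain ⟨k, hk, rfl⟩ := h
    exact ⟨t, .inr j, .inl k, hk.symm, rfl, rfl⟩
  · obtain ⟨rfl, hjk⟩ := h
    exact ⟨t, .inr j, .inr k, hjk, rfl, rfl⟩

theorem eq_of_octVertex_eq {t t' : Cell n} {x y x' y' : Fin 3 ⊕ Fin 3} (h : octahedron.Adj x y)
    (hx : octVertex t x = octVertex t' x') (hy : octVertex t y = octVertex t' y') : t = t' := by
  rcases x with j | j
  · rcases y with k | k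
    · rcases x' with j' | j'
      · rcases y' with k' | k'
        · exact eq_of_two_common_corners h (octVertex_inl_eq_inl_iff.1 hx)
            (octVertex_inl_eq_inl_iff.1 hy)
        · exact (octVertex_inr_eq_iff.1 hy.symm).1
      · exact (octVertex_inr_eq_iff.1 hx.symm).1
    · exact (octVertex_inr_eq_iff.1 hy).1.symm
  · exact (octVertex_inr_eq_iff.1 hx).1.symm

theorem isEdgeDecomposition_octHom : IsEdgeDecomposition (octHom (n := n)) where
  exists_of_adj := exists_octVertex_of_adj
  eq_of_adj h _ hx hy := by
    obtain rfl := eq_of_octVertex_eq h hx hy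
    exact ⟨rfl, octVertex_injective _ hx, octVertex_injective _ hy⟩

end Cells

section Degrees

theorem mem_incidences_inl {t t' : Cell n} {j : Fin 3} {x : Fin 3 ⊕ Fin 3} :
    (t', x) ∈ incidences octHom (octVertex t (.inl j)) ↔
      ∃ k, x = .inl k ∧ corner t j = corner t' k := by
  cases x <;> simp [incidences, octHom, octVertex, eq_comm]

theorem incidences_inr (t : Cell n) (j : Fin 3) :
    incidences octHom (octVertex t (.inr j)) = {(t, .inr j)} := by
  ext ⟨t', x⟩
  simp only [incidences, mem_filter_univ, mem_singleton, Prod.mk.injEq]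
  exact eq_comm.trans octVertex_inr_eq_iff

theorem incidences_tip_of_mem (t : Cell n) (h : t.1.1 + dir t.2 ∈ hexagons n) :
    incidences octHom (octVertex t (.inl 0)) = {(t, .inl 0), (opposite t h, .inl 0)} := by
  ext ⟨t', x⟩
  rw [mem_incidences_inl]
  simp only [corner_eq_corner_iff, mem_insert, mem_singleton, Prod.mk.injEq]
  grind

theorem incidences_tip_of_notMem (t : Cell n) (h : t.1.1 + dir t.2 ∉ hexagons n) :
    incidences octHom (octVertex t (.inl 0)) = {(t, .inl 0)} := by
  ext ⟨t', x⟩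
  rw [mem_incidences_inl]
  simp only [corner_eq_corner_iff, mem_singleton, Prod.mk.injEq]
  grind

theorem incidences_one (t : Cell n) :
    incidences octHom (octVertex t (.inl 1)) = {(t, .inl 1), (next t, .inl 2)} := by
  ext ⟨t', x⟩
  rw [mem_incidences_inl]
  simp only [corner_eq_corner_iff, mem_insert, mem_singleton, Prod.mk.injEq]
  grind

theorem incidences_two (t : Cell n) :
    incidences octHom (octVertex t (.inl 2)) = {(t, .inl 2), (prev t, .inl 1)} := by
  ext ⟨t', x⟩
  rw [mem_incidences_inl]
  simp only [corner_eq_corner_iff, mem_insert, mem_singleton, Prod.mk.injEq]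
  grind

/-- The number of hexagons of `HC(n)` that share side `i` of the hexagon `c`, for `c` in `HC(n)`;
it is also the number of cells that share the tip on this side. -/
noncomputable def sideMult (n : ℕ) (c : ℤ × ℤ) (i : Fin 6) : ℕ :=
  if c + dir i ∈ hexagons n then 2 else 1

/-- The degrees of the six vertices of a cell whose tip lies in `q` cells. -/
def cellDegree (q : ℕ) : Fin 3 ⊕ Fin 3 → ℕ := Sum.elim ![4 * q, 8, 8] fun _ => 4

/-- The neighbour degree sums of the six vertices of a cell, where `p`, `q` and `r` are the numbers
of cells at the tips of the previous cell, of the cell itself and of the next cell. -/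
def cellDegreeSum (p q r : ℕ) : Fin 3 ⊕ Fin 3 → ℕ :=
  Sum.elim ![24 * q, 32 + 4 * q + 4 * r, 32 + 4 * q + 4 * p] ![24, 16 + 4 * q, 16 + 4 * q]

theorem sum_cellDegree (q : ℕ) (x : Fin 3 ⊕ Fin 3) :
    ∑ y ∈ octahedron.neighborFinset x, cellDegree q y =
      ![24, 16 + 4 * q, 16 + 4 * q] (axis x) := by
  rw [sum_neighborFinset_octahedron, sum_filter, Fin.sum_univ_three]
  generalize axis x = j
  fin_cases j <;> simp only [Fin.isValue, Fin.zero_eta, Fin.mk_one, Fin.reduceFinMk, ne_eq,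
    Fin.reduceEq, not_true_eq_false, not_false_eq_true, zero_ne_one, one_ne_zero, ↓reduceIte,
    cellDegree, Sum.elim_inl, Sum.elim_inr, Matrix.cons_val] <;> ring

variable [DecidableRel (network n).Adj]

theorem degree_octVertex (t : Cell n) (x : Fin 3 ⊕ Fin 3) :
    (network n).degree (octVertex t x) = cellDegree (sideMult n t.1 t.2) x := by
  rw [isEdgeDecomposition_octHom.degree_eq isRegularOfDegree_octahedron]
  rcases x with j | j
  · fin_cases j
    · by_cases h : t.1.1 + dir t.2 ∈ hexagons n
      · simp [incidences_tip_of_mem t h, sideMult, cellDegree, h, (opposite_ne_self t h).symm]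
      · simp [incidences_tip_of_notMem t h, sideMult, cellDegree, h]
    · simp [incidences_one, cellDegree]
    · simp [incidences_two, cellDegree]
  · simp [incidences_inr, cellDegree]

theorem neighborDegreeSum_eq (u : Vertex n) :
    (network n).neighborDegreeSum u = ∑ q ∈ incidences octHom u,
      ![24, 16 + 4 * sideMult n q.1.1 q.1.2, 16 + 4 * sideMult n q.1.1 q.1.2] (axis q.2) := by
  rw [SimpleGraph.neighborDegreeSum, isEdgeDecomposition_octHom.sum_neighborFinset]
  refine sum_congr rfl fun q _ => ?_
  rw [← sum_cellDegree]
  exact sum_congr rfl fun y _ => degree_octVertex q.1 y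

theorem neighborDegreeSum_octVertex (t : Cell n) (x : Fin 3 ⊕ Fin 3) :
    (network n).neighborDegreeSum (octVertex t x) =
      cellDegreeSum (sideMult n t.1 (t.2 - 1)) (sideMult n t.1 t.2)
        (sideMult n t.1 (t.2 + 1)) x := by
  rw [neighborDegreeSum_eq]
  rcases x with j | j
  · fin_cases j
    · by_cases h : t.1.1 + dir t.2 ∈ hexagons n
      · simp [incidences_tip_of_mem t h, sideMult, cellDegreeSum, axis, h,
          (opposite_ne_self t h).symm]
      · simp [incidences_tip_of_notMem t h, sideMult, cellDegreeSum, axis, h]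
    · rw [Fin.mk_one, incidences_one, sum_pair (by simp)]
      simp only [axis, next, cellDegreeSum, Sum.elim_inl, id_eq, Matrix.cons_val]
      ring
    · simp only [Fin.reduceFinMk]
      rw [incidences_two, sum_pair (by simp)]
      simp only [axis, prev, cellDegreeSum, Sum.elim_inl, id_eq, Matrix.cons_val]
      ring
  · fin_cases j <;> simp [incidences_inr, cellDegreeSum, axis]

end Degrees

section Hexagons

theorem mem_hexagons {c : ℤ × ℤ} :
    c ∈ hexagons n ↔ ((-(n : ℤ) < c.1 ∧ c.1 < n) ∧ -(n : ℤ) < c.2 ∧ c.2 < n) ∧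
      -(n : ℤ) < c.1 + c.2 ∧ c.1 + c.2 < n := by
  simp [hexagons]

theorem zero_mem_hexagons (hn : 1 ≤ n) : 0 ∈ hexagons n := by
  simp only [mem_hexagons, Prod.fst_zero, Prod.snd_zero]
  omega

/-- The rotation of the lattice by 60 degrees. -/
def rotate : ℤ × ℤ ≃ ℤ × ℤ where
  toFun c := (-c.2, c.1 + c.2)
  invFun c := (c.1 + c.2, -c.1)
  left_inv c := by simp
  right_inv c := by simp

theorem rotate_add (c d : ℤ × ℤ) : rotate (c + d) = rotate c + rotate d := by
  ext <;> simp only [rotate, Equiv.coe_fn_mk, Prod.fst_add, Prod.snd_add] <;> ring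

theorem rotate_dir : ∀ i, rotate (dir i) = dir (i + 1) := by
  decide

theorem rotate_mem_hexagons {c : ℤ × ℤ} : rotate c ∈ hexagons n ↔ c ∈ hexagons n := by
  simp only [mem_hexagons, rotate, Equiv.coe_fn_mk]
  omega

theorem sideMult_rotate (c : ℤ × ℤ) (i : Fin 6) :
    sideMult n (rotate c) (i + 1) = sideMult n c i := by
  simp only [sideMult, ← rotate_dir, ← rotate_add, rotate_mem_hexagons]

theorem sum_hexagons_of_rotate {M : Type*} [AddCommMonoid M] {F : ℤ × ℤ → Fin 6 → M}
    (hF : ∀ c i, F (rotate c) (i + 1) = F c i) (i : Fin 6) :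
    ∑ c ∈ hexagons n, F c i = ∑ c ∈ hexagons n, F c 0 := by
  induction i using Fin.induction with
  | zero => rfl
  | succ i ih =>
    rw [← ih, ← Fin.coeSucc_eq_succ]
    exact (sum_equiv rotate (fun c => rotate_mem_hexagons.symm) fun c _ => (hF c _).symm).symm

-- Removing the centre leaves three congruent rhombi, spanned by pairs of unit vectors that enclose
-- an angle of 120 degrees.
theorem card_hexagons (hn : 1 ≤ n) : #(hexagons n) = 3 * (n * (n - 1)) + 1 := by
  have hrhombi : #((hexagons n).erase 0) =
      #(univ ×ˢ range (n - 1) ×ˢ range n : Finset (Fin 3 × ℕ × ℕ)) := by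
    symm
    refine card_bij (fun p _ => ![((p.2.1 : ℤ) + 1 - p.2.2, (p.2.2 : ℤ)),
      (-(p.2.1 : ℤ) - 1, (p.2.1 : ℤ) + 1 - p.2.2), ((p.2.2 : ℤ), -(p.2.1 : ℤ) - 1)] p.1) ?_ ?_ ?_
    · rintro ⟨k, i, j⟩ h
      simp only [mem_product, mem_univ, mem_range, true_and] at h
      rw [mem_erase, mem_hexagons, Ne, Prod.ext_iff]
      fin_cases k <;> simp only [Fin.zero_eta, Fin.mk_one, Fin.reduceFinMk, Matrix.cons_val,
        Prod.fst_zero, Prod.snd_zero] <;> omega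
    · rintro ⟨k, i, j⟩ h ⟨k', i', j'⟩ h' e
      simp only [mem_product, mem_univ, mem_range, true_and] at h h'
      fin_cases k <;> fin_cases k' <;> simp only [Fin.zero_eta, Fin.mk_one, Fin.reduceFinMk,
        Matrix.cons_val, Prod.mk.injEq, true_and] at e ⊢ <;> omega
    · rintro ⟨a, b⟩ h
      rw [mem_erase, mem_hexagons, Ne, Prod.ext_iff] at h
      simp only [Prod.fst_zero, Prod.snd_zero] at h
      simp only [mem_product, mem_univ, mem_range, true_and]
      obtain h' | h' | h' : (0 < a + b ∧ 0 ≤ b) ∨ (a < 0 ∧ a + b ≤ 0) ∨ (b < 0 ∧ 0 ≤ a) := by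
        omega
      · exact ⟨(0, (a + b - 1).toNat, b.toNat), by simp only; omega,
          by simp only [Matrix.cons_val, Prod.mk.injEq]; omega⟩
      · exact ⟨(1, (-a - 1).toNat, (-(a + b)).toNat), by simp only; omega,
          by simp only [Matrix.cons_val, Prod.mk.injEq]; omega⟩
      · exact ⟨(2, (-b - 1).toNat, a.toNat), by simp only; omega,
          by simp only [Matrix.cons_val, Prod.mk.injEq]; omega⟩
  rw [card_product, card_product, card_univ, Fintype.card_fin, card_range, card_range] at hrhombi
  rw [← card_erase_add_one (zero_mem_hexagons hn), hrhombi]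
  ring

end Hexagons

section Patterns

theorem sideMult_eq_one {c : ℤ × ℤ} {i : Fin 6} : sideMult n c i = 1 ↔ c + dir i ∉ hexagons n := by
  simp [sideMult]

theorem sideMult_eq_two {c : ℤ × ℤ} {i : Fin 6} : sideMult n c i = 2 ↔ c + dir i ∈ hexagons n := by
  simp [sideMult]

/-- The hexagons of `HC(n)` whose sides 5, 0 and 1 have the given numbers of hexagons on them. -/
noncomputable def hexagonsOfSides (n : ℕ) (p : ℕ × ℕ × ℕ) : Finset (ℤ × ℤ) :=
  {c ∈ hexagons n | (sideMult n c 5, sideMult n c 0, sideMult n c 1) = p}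

theorem mem_hexagonsOfSides {c : ℤ × ℤ} {p q r : ℕ} :
    c ∈ hexagonsOfSides n (p, q, r) ↔
      c ∈ hexagons n ∧ sideMult n c 5 = p ∧ sideMult n c 0 = q ∧ sideMult n c 1 = r := by
  simp [hexagonsOfSides]

theorem hexagonsOfSides_one_one_one (hn : 1 ≤ n) :
    hexagonsOfSides n (1, 1, 1) = {((n : ℤ) - 1, 0)} := by
  ext ⟨a, b⟩
  simp only [mem_hexagonsOfSides, sideMult_eq_one, mem_hexagons, dir, mem_singleton,
    Prod.mk.injEq, Prod.mk_add_mk, Matrix.cons_val]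
  omega

theorem hexagonsOfSides_one_two_one : hexagonsOfSides n (1, 2, 1) = ∅ := by
  refine eq_empty_of_forall_notMem fun ⟨a, b⟩ h => ?_
  simp only [mem_hexagonsOfSides, sideMult_eq_one, sideMult_eq_two, mem_hexagons, dir,
    Prod.mk_add_mk, Matrix.cons_val] at h
  omega

theorem hexagonsOfSides_two_one_two : hexagonsOfSides n (2, 1, 2) = ∅ := by
  refine eq_empty_of_forall_notMem fun ⟨a, b⟩ h => ?_
  simp only [mem_hexagonsOfSides, sideMult_eq_one, sideMult_eq_two, mem_hexagons, dir,
    Prod.mk_add_mk, Matrix.cons_val] at h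
  omega

theorem card_hexagonsOfSides_one_one_two : #(hexagonsOfSides n (1, 1, 2)) = n - 1 := by
  refine card_eq_of_bijective (fun k _ => ((n : ℤ) - 1, -1 - (k : ℤ)))
    (fun ⟨a, b⟩ h => ?_) (fun k h => ?_) fun k l _ _ h => by simpa using h
  all_goals simp only [mem_hexagonsOfSides, sideMult_eq_one, sideMult_eq_two, mem_hexagons, dir,
    Prod.mk_add_mk, Matrix.cons_val] at h ⊢
  · exact ⟨(-1 - b).toNat, by omega, Prod.ext (by simp only; omega) (by simp only; omega)⟩
  · omega

theorem card_hexagonsOfSides_two_one_one : #(hexagonsOfSides n (2, 1, 1)) = n - 1 := by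
  refine card_eq_of_bijective (fun k _ => ((k : ℤ), (n : ℤ) - 1 - k))
    (fun ⟨a, b⟩ h => ?_) (fun k h => ?_) fun k l _ _ h => by simpa using h
  all_goals simp only [mem_hexagonsOfSides, sideMult_eq_one, sideMult_eq_two, mem_hexagons, dir,
    Prod.mk_add_mk, Matrix.cons_val] at h ⊢
  · exact ⟨a.toNat, by omega, Prod.ext (by simp only; omega) (by simp only; omega)⟩
  · omega

theorem card_hexagonsOfSides_two_two_one : #(hexagonsOfSides n (2, 2, 1)) = n - 1 := by
  refine card_eq_of_bijective (fun k _ => (-1 - (k : ℤ), (n : ℤ) - 1))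
    (fun ⟨a, b⟩ h => ?_) (fun k h => ?_) fun k l _ _ h => by simpa using h
  all_goals simp only [mem_hexagonsOfSides, sideMult_eq_one, sideMult_eq_two, mem_hexagons, dir,
    Prod.mk_add_mk, Matrix.cons_val] at h ⊢
  · exact ⟨(-1 - a).toNat, by omega, Prod.ext (by simp only; omega) (by simp only; omega)⟩
  · omega

theorem card_hexagonsOfSides_one_two_two : #(hexagonsOfSides n (1, 2, 2)) = n - 1 := by
  refine card_eq_of_bijective (fun k _ => ((k : ℤ), 1 - (n : ℤ)))
    (fun ⟨a, b⟩ h => ?_) (fun k h => ?_) fun k l _ _ h => by simpa using h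
  all_goals simp only [mem_hexagonsOfSides, sideMult_eq_one, sideMult_eq_two, mem_hexagons, dir,
    Prod.mk_add_mk, Matrix.cons_val] at h ⊢
  · exact ⟨a.toNat, by omega, Prod.ext (by simp only; omega) (by simp only; omega)⟩
  · omega

theorem sum_hexagons_eq_sum_card (K : ℕ → ℕ → ℕ → ℝ) :
    ∑ c ∈ hexagons n, K (sideMult n c 5) (sideMult n c 0) (sideMult n c 1) =
      ∑ p ∈ ({1, 2} : Finset ℕ), ∑ q ∈ ({1, 2} : Finset ℕ), ∑ r ∈ ({1, 2} : Finset ℕ),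
        #(hexagonsOfSides n (p, q, r)) * K p q r := by
  have hmaps : ∀ c ∈ hexagons n, (sideMult n c 5, sideMult n c 0, sideMult n c 1) ∈
      ({1, 2} : Finset ℕ) ×ˢ ({1, 2} : Finset ℕ) ×ˢ ({1, 2} : Finset ℕ) := by
    intro c _
    simp only [mem_product, mem_insert, mem_singleton, sideMult_eq_one, sideMult_eq_two]
    exact ⟨em' _, em' _, em' _⟩
  rw [← sum_fiberwise_of_maps_to hmaps, sum_product]
  simp only [sum_product]
  refine sum_congr rfl fun p _ => sum_congr rfl fun q _ => sum_congr rfl fun r _ => ?_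
  rw [← nsmul_eq_mul, ← sum_const]
  refine sum_congr rfl fun c hc => ?_
  obtain ⟨-, rfl, rfl, rfl⟩ := mem_hexagonsOfSides.1 hc
  rfl

theorem sum_hexagons_eq_add_card_mul (hn : 1 ≤ n) (K : ℕ → ℕ → ℕ → ℝ) :
    ∑ c ∈ hexagons n, K (sideMult n c 5) (sideMult n c 0) (sideMult n c 1) =
      K 1 1 1 + (n - 1) * (K 1 1 2 + K 2 1 1 + K 2 2 1 + K 1 2 2) +
        #(hexagonsOfSides n (2, 2, 2)) * K 2 2 2 := by
  simp only [sum_hexagons_eq_sum_card, sum_pair (show (1 : ℕ) ≠ 2 by decide),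
    hexagonsOfSides_one_one_one hn, hexagonsOfSides_one_two_one, hexagonsOfSides_two_one_two,
    card_hexagonsOfSides_one_one_two, card_hexagonsOfSides_two_one_one,
    card_hexagonsOfSides_two_two_one, card_hexagonsOfSides_one_two_two, card_singleton,
    card_empty, Nat.cast_sub hn]
  push_cast
  ring

theorem card_hexagonsOfSides_two_two_two (hn : 1 ≤ n) :
    (#(hexagonsOfSides n (2, 2, 2)) : ℝ) = 3 * n ^ 2 - 7 * n + 4 := by
  have htotal := sum_hexagons_eq_add_card_mul hn fun _ _ _ => 1
  rw [sum_const, card_hexagons hn, nsmul_eq_mul] at htotal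
  push_cast [Nat.cast_sub hn] at htotal
  linear_combination -htotal

theorem sum_hexagons (hn : 1 ≤ n) (K : ℕ → ℕ → ℕ → ℝ) :
    ∑ c ∈ hexagons n, K (sideMult n c 5) (sideMult n c 0) (sideMult n c 1) =
      K 1 1 1 + (n - 1) * (K 1 1 2 + K 2 1 1 + K 2 2 1 + K 1 2 2) +
        (3 * n ^ 2 - 7 * n + 4) * K 2 2 2 := by
  rw [sum_hexagons_eq_add_card_mul hn, card_hexagonsOfSides_two_two_two hn]

theorem sum_cells (hn : 1 ≤ n) (K : ℕ → ℕ → ℕ → ℝ) :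
    ∑ t : Cell n, K (sideMult n t.1 (t.2 - 1)) (sideMult n t.1 t.2) (sideMult n t.1 (t.2 + 1)) =
      6 * (K 1 1 1 + (n - 1) * (K 1 1 2 + K 2 1 1 + K 2 2 1 + K 1 2 2) +
        (3 * n ^ 2 - 7 * n + 4) * K 2 2 2) := by
  let F (c : ℤ × ℤ) (i : Fin 6) : ℝ :=
    K (sideMult n c (i - 1)) (sideMult n c i) (sideMult n c (i + 1))
  have hF (c : ℤ × ℤ) (i : Fin 6) : F (rotate c) (i + 1) = F c i := by
    have hsub := sideMult_rotate (n := n) c (i - 1)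
    rw [sub_add_cancel] at hsub
    simp only [F, sideMult_rotate, add_sub_cancel_right, hsub]
  calc ∑ t : Cell n, F t.1 t.2
      = ∑ i : Fin 6, ∑ c ∈ hexagons n, F c i := by
        rw [Fintype.sum_prod_type_right]
        exact sum_congr rfl fun i _ => sum_coe_sort (hexagons n) fun c => F c i
    _ = ∑ _i : Fin 6, ∑ c ∈ hexagons n, F c 0 :=
        sum_congr rfl fun i _ => sum_hexagons_of_rotate hF i
    _ = 6 * ∑ c ∈ hexagons n, F c 0 := by simp
    _ = _ := congrArg (6 * ·) (sum_hexagons hn K)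

end Patterns

section EdgePartitions

theorem edgeSum_network [DecidableRel (network n).Adj] (hn : 1 ≤ n) {s : Vertex n → ℕ}
    {L : ℕ → ℕ → ℕ → Fin 3 ⊕ Fin 3 → ℕ}
    (hs : ∀ t x, s (octVertex t x) = L (sideMult n t.1 (t.2 - 1)) (sideMult n t.1 t.2)
      (sideMult n t.1 (t.2 + 1)) x)
    {w : ℕ → ℕ → ℝ} (hw : ∀ a b, w a b = w b a) :
    let E p q r := octahedron.edgeSum (fun x y => w (L p q r x) (L p q r y)) fun _ _ => hw _ _
    (network n).edgeSum (fun u v => w (s u) (s v)) (fun _ _ => hw _ _) =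
      6 * (E 1 1 1 + (n - 1) * (E 1 1 2 + E 2 1 1 + E 2 2 1 + E 1 2 2) +
        (3 * n ^ 2 - 7 * n + 4) * E 2 2 2) := by
  intro E
  rw [isEdgeDecomposition_octHom.edgeSum_eq, ← sum_cells hn E]
  refine sum_congr rfl fun t _ => ?_
  simp only [octHom, RelHom.coeFn_mk, hs, E]

variable [DecidableRel (network n).Adj]

theorem edgeSum_degree (hn : 1 ≤ n) {w : ℕ → ℕ → ℝ} (hw : ∀ a b, w a b = w b a) :
    (network n).edgeSum (fun u v => w ((network n).degree u) ((network n).degree v))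
        (fun _ _ => hw _ _) =
      (54 * n ^ 2 - 30 * n + 6) * w 4 4 + (108 * n ^ 2 - 108 * n + 36) * w 4 8 +
        (54 * n ^ 2 - 78 * n + 30) * w 8 8 := by
  rw [edgeSum_network hn (L := fun _ q _ => cellDegree q) degree_octVertex hw]
  simp only [edgeSum_octahedron, Fin.sum_univ_three, cellDegree, Sum.elim_inl, Sum.elim_inr,
    Fin.isValue, Fin.reduceAdd, Nat.reduceMul, Matrix.cons_val, hw 8 4]
  ring

theorem edgeSum_neighborDegreeSum (hn : 1 ≤ n) {w : ℕ → ℕ → ℝ} (hw : ∀ a b, w a b = w b a) :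
    (network n).edgeSum
        (fun u v => w ((network n).neighborDegreeSum u) ((network n).neighborDegreeSum v))
        (fun _ _ => hw _ _) =
      (12 * n - 6) * w 20 20 + (48 * n - 24) * w 20 24 + 12 * n * w 20 40 +
        12 * (n - 1) * w 20 44 + (54 * n ^ 2 - 90 * n + 36) * w 24 24 + 24 * n * w 24 40 +
        48 * (n - 1) * w 24 44 + (108 * n ^ 2 - 204 * n + 96) * w 24 48 + 6 * w 40 40 +
        12 * (n - 1) * w 40 44 + 24 * (n - 1) * w 44 48 +
        (54 * n ^ 2 - 114 * n + 60) * w 48 48 := by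
  rw [edgeSum_network hn neighborDegreeSum_octVertex hw]
  simp only [edgeSum_octahedron, Fin.sum_univ_three, cellDegreeSum, Sum.elim_inl, Sum.elim_inr,
    Fin.isValue, Fin.reduceAdd, Nat.reduceMul, Nat.reduceAdd, Matrix.cons_val, hw 24 20, hw 40 20,
    hw 44 20, hw 40 24, hw 44 24, hw 48 24, hw 44 40, hw 48 44]
  ring

end EdgePartitions

section Indices

/-- The weight of an edge in the indices `ABC` and `ABC4`, as a function of the two labels. -/
noncomputable def abcWeight (a b : ℕ) : ℝ := √(((a : ℝ) + b - 2) / ((a : ℝ) * b))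

/-- The weight of an edge in the indices `GA` and `GA5`, as a function of the two labels. -/
noncomputable def gaWeight (a b : ℕ) : ℝ := 2 * √((a : ℝ) * b) / ((a : ℝ) + b)

theorem abcWeight_comm (a b : ℕ) : abcWeight a b = abcWeight b a := by
  rw [abcWeight, abcWeight, add_comm (a : ℝ), mul_comm (a : ℝ)]

theorem gaWeight_comm (a b : ℕ) : gaWeight a b = gaWeight b a := by
  rw [gaWeight, gaWeight, add_comm (a : ℝ), mul_comm (a : ℝ)]

theorem sqrt_eq_mul_sqrt {x r k : ℝ} (hr : 0 ≤ r) (h : x = r ^ 2 * k) : √x = r * √k := by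
  rw [h, Real.sqrt_mul (sq_nonneg r), Real.sqrt_sq hr]

theorem abcWeight_eq_mul_sqrt {a b : ℕ} {r k : ℝ} (hr : 0 ≤ r)
    (h : ((a : ℝ) + b - 2) / (a * b) = r ^ 2 * k) : abcWeight a b = r * √k :=
  sqrt_eq_mul_sqrt hr h

theorem gaWeight_eq_mul_sqrt {a b : ℕ} {r k : ℝ} (hr : 0 ≤ r)
    (h : 2 ^ 2 * ((a : ℝ) * b) / (a + b) ^ 2 = r ^ 2 * k) : gaWeight a b = r * √k := by
  rw [← sqrt_eq_mul_sqrt hr h, Real.sqrt_div (by positivity), Real.sqrt_sq (by positivity),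
    sqrt_eq_mul_sqrt zero_le_two rfl, gaWeight]

theorem gaWeight_self {a : ℕ} (ha : a ≠ 0) : gaWeight a a = 1 := by
  rw [gaWeight_eq_mul_sqrt (r := 1) (k := 1) zero_le_one (by field_simp; norm_num), Real.sqrt_one,
    one_mul]

variable [DecidableRel (network n).Adj]

theorem ABC_network (hn : 1 ≤ n) :
    (network n).ABC =
      (54 * n ^ 2 - 30 * n + 6) * (1 / 4 * √6) + (108 * n ^ 2 - 108 * n + 36) * (1 / 4 * √5) +
        (54 * n ^ 2 - 78 * n + 30) * (1 / 8 * √14) := by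
  have h₁ : abcWeight 4 4 = 1 / 4 * √6 := abcWeight_eq_mul_sqrt (by norm_num) (by norm_num)
  have h₂ : abcWeight 4 8 = 1 / 4 * √5 := abcWeight_eq_mul_sqrt (by norm_num) (by norm_num)
  have h₃ : abcWeight 8 8 = 1 / 8 * √14 := abcWeight_eq_mul_sqrt (by norm_num) (by norm_num)
  rw [← h₁, ← h₂, ← h₃]
  exact edgeSum_degree hn abcWeight_comm

theorem GA_network (hn : 1 ≤ n) :
    (network n).GA =
      (54 * n ^ 2 - 30 * n + 6) + (108 * n ^ 2 - 108 * n + 36) * (2 / 3 * √2) +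
        (54 * n ^ 2 - 78 * n + 30) := by
  have h : gaWeight 4 8 = 2 / 3 * √2 := gaWeight_eq_mul_sqrt (by norm_num) (by norm_num)
  refine (edgeSum_degree hn gaWeight_comm).trans ?_
  rw [h, gaWeight_self four_ne_zero, gaWeight_self (by decide), mul_one, mul_one]

theorem ABC4_network (hn : 1 ≤ n) :
    (network n).ABC4 =
      (12 * n - 6) * (1 / 20 * √38) + (48 * n - 24) * (1 / 20 * √35) + 12 * n * (1 / 20 * √29) +
        12 * (n - 1) * (1 / 220 * √3410) + (54 * n ^ 2 - 90 * n + 36) * (1 / 24 * √46) +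
        24 * n * (1 / 120 * √930) + 48 * (n - 1) * (1 / 4) +
        (108 * n ^ 2 - 204 * n + 96) * (1 / 24 * √35) + 6 * (1 / 40 * √78) +
        12 * (n - 1) * (1 / 220 * √2255) + 24 * (n - 1) * (1 / 88 * √330) +
        (54 * n ^ 2 - 114 * n + 60) * (1 / 48 * √94) := by
  have h₂₀₂₀ : abcWeight 20 20 = 1 / 20 * √38 := abcWeight_eq_mul_sqrt (by norm_num) (by norm_num)
  have h₂₀₂₄ : abcWeight 20 24 = 1 / 20 * √35 := abcWeight_eq_mul_sqrt (by norm_num) (by norm_num)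
  have h₂₀₄₀ : abcWeight 20 40 = 1 / 20 * √29 := abcWeight_eq_mul_sqrt (by norm_num) (by norm_num)
  have h₂₀₄₄ : abcWeight 20 44 = 1 / 220 * √3410 :=
    abcWeight_eq_mul_sqrt (by norm_num) (by norm_num)
  have h₂₄₂₄ : abcWeight 24 24 = 1 / 24 * √46 := abcWeight_eq_mul_sqrt (by norm_num) (by norm_num)
  have h₂₄₄₀ : abcWeight 24 40 = 1 / 120 * √930 := abcWeight_eq_mul_sqrt (by norm_num) (by norm_num)
  have h₂₄₄₄ : abcWeight 24 44 = 1 / 4 * √1 := abcWeight_eq_mul_sqrt (by norm_num) (by norm_num)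
  have h₂₄₄₈ : abcWeight 24 48 = 1 / 24 * √35 := abcWeight_eq_mul_sqrt (by norm_num) (by norm_num)
  have h₄₀₄₀ : abcWeight 40 40 = 1 / 40 * √78 := abcWeight_eq_mul_sqrt (by norm_num) (by norm_num)
  have h₄₀₄₄ : abcWeight 40 44 = 1 / 220 * √2255 :=
    abcWeight_eq_mul_sqrt (by norm_num) (by norm_num)
  have h₄₄₄₈ : abcWeight 44 48 = 1 / 88 * √330 := abcWeight_eq_mul_sqrt (by norm_num) (by norm_num)
  have h₄₈₄₈ : abcWeight 48 48 = 1 / 48 * √94 := abcWeight_eq_mul_sqrt (by norm_num) (by norm_num)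
  refine (edgeSum_neighborDegreeSum hn abcWeight_comm).trans ?_
  rw [h₂₀₂₀, h₂₀₂₄, h₂₀₄₀, h₂₀₄₄, h₂₄₂₄, h₂₄₄₀, h₂₄₄₄, h₂₄₄₈, h₄₀₄₀,
    h₄₀₄₄, h₄₄₄₈, h₄₈₄₈, Real.sqrt_one, mul_one]

theorem GA5_network (hn : 1 ≤ n) :
    (network n).GA5 =
      (12 * n - 6) + (48 * n - 24) * (2 / 11 * √30) + 12 * n * (2 / 3 * √2) +
        12 * (n - 1) * (1 / 8 * √55) + (54 * n ^ 2 - 90 * n + 36) + 24 * n * (1 / 4 * √15) +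
        48 * (n - 1) * (2 / 17 * √66) + (108 * n ^ 2 - 204 * n + 96) * (2 / 3 * √2) + 6 +
        12 * (n - 1) * (2 / 21 * √110) + 24 * (n - 1) * (4 / 23 * √33) +
        (54 * n ^ 2 - 114 * n + 60) := by
  have h₂₀₂₄ : gaWeight 20 24 = 2 / 11 * √30 := gaWeight_eq_mul_sqrt (by norm_num) (by norm_num)
  have h₂₀₄₀ : gaWeight 20 40 = 2 / 3 * √2 := gaWeight_eq_mul_sqrt (by norm_num) (by norm_num)
  have h₂₀₄₄ : gaWeight 20 44 = 1 / 8 * √55 := gaWeight_eq_mul_sqrt (by norm_num) (by norm_num)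
  have h₂₄₄₀ : gaWeight 24 40 = 1 / 4 * √15 := gaWeight_eq_mul_sqrt (by norm_num) (by norm_num)
  have h₂₄₄₄ : gaWeight 24 44 = 2 / 17 * √66 := gaWeight_eq_mul_sqrt (by norm_num) (by norm_num)
  have h₂₄₄₈ : gaWeight 24 48 = 2 / 3 * √2 := gaWeight_eq_mul_sqrt (by norm_num) (by norm_num)
  have h₄₀₄₄ : gaWeight 40 44 = 2 / 21 * √110 := gaWeight_eq_mul_sqrt (by norm_num) (by norm_num)
  have h₄₄₄₈ : gaWeight 44 48 = 4 / 23 * √33 := gaWeight_eq_mul_sqrt (by norm_num) (by norm_num)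
  refine (edgeSum_neighborDegreeSum hn gaWeight_comm).trans ?_
  simp only [gaWeight_self, ne_eq, OfNat.ofNat_ne_zero, not_false_eq_true, mul_one,
    h₂₀₂₄, h₂₀₄₀, h₂₀₄₄, h₂₄₄₀, h₂₄₄₄, h₂₄₄₈, h₄₀₄₄, h₄₄₄₈]

end Indices

end DPOH

theorem theorem9_general {n : ℕ} (hn : 1 ≤ n) {V : Type*} [Fintype V] (G : SimpleGraph V)
    [DecidableRel G.Adj] (hG : Nonempty (G ≃g DPOH.network n)) :
    (G.ABC = 1 / 8 * (72 * √5 * (1 - 3 * n + 3 * n ^ 2)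
        + 6 * √14 * (5 - 13 * n + 9 * n ^ 2)
        + 12 * √6 * (1 - 5 * n + 9 * n ^ 2)) ∧
      G.GA = 12 * (3 + 2 * √2) * (1 - 3 * n + 3 * n ^ 2)) ∧
    G.ABC4 = 1 / 440 * (66 * √78 + 5280 * (-1 + n) + 120 * √330 * (-1 + n)
        + 24 * √2255 * (-1 + n) + 24 * √3410 * (-1 + n)
        + 264 * √29 * n + 88 * √930 * n
        + 528 * √35 * (-1 + 2 * n) + 132 * √38 * (-1 + 2 * n)
        + 330 * √46 * (2 - 5 * n + 3 * n ^ 2)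
        + 55 * √94 * (10 - 19 * n + 9 * n ^ 2)
        + 220 * √35 * (8 - 17 * n + 9 * n ^ 2)) ∧
      G.GA5 = 96 + 96 / 23 * √33 * (-1 + n) + 3 / 2 * √55 * (-1 + n)
        + 96 / 17 * √66 * (-1 + n) + 8 / 7 * √110 * (-1 + n)
        - 192 * n + 8 * √2 * n + 6 * √15 * n + 108 * n ^ 2
        + 48 / 11 * √30 * (-1 + 2 * n) + 8 * √2 * (8 - 17 * n + 9 * n ^ 2) := by
  classical
  obtain ⟨e⟩ := hG
  rw [ABC_iso e, GA_iso e, ABC4_iso e, GA5_iso e, DPOH.ABC_network hn, DPOH.GA_network hn,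
    DPOH.ABC4_network hn, DPOH.GA5_network hn]
  refine ⟨⟨?_, ?_⟩, ?_, ?_⟩ <;> ring

theorem theorem9 (n : ℕ) {V : Type*} [Fintype V] [DecidableEq V]
    (G : SimpleGraph V) [DecidableRel G.Adj] (hG : Nonempty (G ≃g DPOH.network n)) :
    (1 ≤ n →
      G.ABC = 1 / 8 * (72 * √5 * (1 - 3 * n + 3 * n ^ 2)
        + 6 * √14 * (5 - 13 * n + 9 * n ^ 2)
        + 12 * √6 * (1 - 5 * n + 9 * n ^ 2)) ∧
      G.GA = 12 * (3 + 2 * √2) * (1 - 3 * n + 3 * n ^ 2)) ∧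
    (3 ≤ n →
      G.ABC4 = 1 / 440 * (66 * √78 + 5280 * (-1 + n) + 120 * √330 * (-1 + n)
        + 24 * √2255 * (-1 + n) + 24 * √3410 * (-1 + n)
        + 264 * √29 * n + 88 * √930 * n
        + 528 * √35 * (-1 + 2 * n) + 132 * √38 * (-1 + 2 * n)
        + 330 * √46 * (2 - 5 * n + 3 * n ^ 2)
        + 55 * √94 * (10 - 19 * n + 9 * n ^ 2)
        + 220 * √35 * (8 - 17 * n + 9 * n ^ 2)) ∧
      G.GA5 = 96 + 96 / 23 * √33 * (-1 + n) + 3 / 2 * √55 * (-1 + n)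
        + 96 / 17 * √66 * (-1 + n) + 8 / 7 * √110 * (-1 + n)
        - 192 * n + 8 * √2 * n + 6 * √15 * n + 108 * n ^ 2
        + 48 / 11 * √30 * (-1 + 2 * n) + 8 * √2 * (8 - 17 * n + 9 * n ^ 2)) := by
  exact ⟨fun hn => (theorem9_general hn G hG).1, fun hn => (theorem9_general (by omega) G hG).2⟩
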